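/- Let $X$ be a set and $\mathcal F$ a collection of subsets of $X$. For $Y\subseteq X$ and an ultrafilter $\mathscr U$ on $Y$ put $$Y_{\mathcal F}(\mathscr U):=\{x\in X : \text{for all } F\in\mathcal F,\ x\in F \iff F\cap Y\in\mathscr U\}.$$ The subsets $Y$ of $X$ with $Y_{\mathcal F}(\mathscr U)\subseteq Y$ for every ultrafilter $\mathscr U$ on $Y$ are the closed sets of a topology on $X$, called the $\mathcal F$-ultrafilter topology. The patch topology of a topological space is the topology having as a subbasis of open sets the compact open subsets and their complements. Compact means that every open cover has a finite subcover (no separation is assumed). A topological space is spectral if it is homeomorphic to $\operatorname{Spec}(A)$, with the Zariski topology, for some commutative ring $A$ with identity. Proposition. Let $X$ be a topological space with topology $\mathcal T$, and let $\mathcal B$ be a basis of open sets of $X$. 1. The $\mathcal B$-ultrafilter topology is finer than or equal to $\mathcal T$. 2. If $X$ is $T_0$, then the $\mathcal B$-ultrafilter topology is Hausdorff and totally disconnected. In particular, if $X$ is $T_0$ but not Hausdorff, then the $\mathcal B$-ultrafilter topology is strictly finer than $\mathcal T$. 3. If $X$ is $T_0$ and $X$ with the $\mathcal B$-ultrafilter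 topology is compact, then (a) the $\mathcal B$-ultrafilter topology is the coarsest topology on $X$ for which every member of $\mathcal B$ is clopen; (b) the patch topology of $(X,\mathcal T)$ is equal to the $\mathcal B$-ultrafilter topology; (c) $X$ with the topology $\mathcal T$ is a spectral space. -/

import Mathlib

open Set

universe u

/-- The set `Y_𝓕(𝒰)` of ultrafilter limit points: for a collection `𝓕` of subsets of `X`, a subset
`Y` of `X` and an ultrafilter `𝒰` on `Y`, the points `x` of `X` such that for every `F ∈ 𝓕`,
`x ∈ F` if and only if `F ∩ Y ∈ 𝒰` (here `F ∩ Y` is seen as a subset of `Y`). -/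
def ultrafilterLimitPoints {X : Type u} (𝓕 : Set (Set X)) (Y : Set X) (𝒰 : Ultrafilter Y) :
    Set X :=
  {x | ∀ F ∈ 𝓕, x ∈ F ↔ (Subtype.val ⁻¹' F : Set Y) ∈ 𝒰}

/-- `Y` is `𝓕`-stable under ultrafilters if `Y_𝓕(𝒰) ⊆ Y` for every ultrafilter `𝒰` on `Y`. -/
def StableUnderUltrafilters {X : Type u} (𝓕 : Set (Set X)) (Y : Set X) : Prop :=
  ∀ 𝒰 : Ultrafilter Y, ultrafilterLimitPoints 𝓕 Y 𝒰 ⊆ Y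

theorem stableUnderUltrafilters_iff {X : Type u} (𝓕 : Set (Set X)) (Y : Set X) :
    StableUnderUltrafilters 𝓕 Y ↔
      ∀ 𝒱 : Ultrafilter X, Y ∈ 𝒱 → ∀ x, (∀ F ∈ 𝓕, x ∈ F ↔ F ∈ 𝒱) → x ∈ Y := by
  constructor
  · intro h 𝒱 hY x hx
    have hr : range (Subtype.val : Y → X) ∈ 𝒱 := by simpa using hY
    refine h (𝒱.comap Subtype.val_injective hr) fun F hF => ?_
    rw [hx F hF, ← Ultrafilter.mem_coe (f := 𝒱.comap Subtype.val_injective hr),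
      Ultrafilter.coe_comap, Filter.mem_comap]
    constructor
    · intro hF'
      exact ⟨F, hF', Subset.rfl⟩
    · rintro ⟨T, hT, hTF⟩
      exact Filter.mem_of_superset (Filter.inter_mem hT hY) fun y hy => @hTF ⟨y, hy.2⟩ hy.1
  · intro h 𝒰 x hx
    refine h (𝒰.map Subtype.val) ?_ x hx
    rw [Ultrafilter.mem_map, Subtype.coe_preimage_self]
    exact Filter.univ_mem

/-- The `𝓕`-ultrafilter topology on `X`: its closed sets are the subsets of `X` that are
`𝓕`-stable under ultrafilters. -/
@[reducible]
def ultrafilterTopology {X : Type u} (𝓕 : Set (Set X)) : TopologicalSpace X :=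
  TopologicalSpace.ofClosed {Y | StableUnderUltrafilters 𝓕 Y}
    (fun 𝒰 => (𝒰.nonempty_of_mem Filter.univ_mem).elim fun y _ => y.2.elim)
    (by
      intro 𝓖 h𝓖
      refine (stableUnderUltrafilters_iff 𝓕 _).2 fun 𝒱 h𝒱 x hx C hC => ?_
      exact (stableUnderUltrafilters_iff 𝓕 C).1 (h𝓖 hC) 𝒱
        (Filter.mem_of_superset h𝒱 (sInter_subset_of_mem hC)) x hx)
    (by
      intro C hC D hD
      refine (stableUnderUltrafilters_iff 𝓕 _).2 fun 𝒱 h𝒱 x hx => ?_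
      rcases Ultrafilter.union_mem_iff.1 h𝒱 with h | h
      · exact Or.inl ((stableUnderUltrafilters_iff 𝓕 C).1 hC 𝒱 h x hx)
      · exact Or.inr ((stableUnderUltrafilters_iff 𝓕 D).1 hD 𝒱 h x hx))

/-- A topological space is spectral if it is homeomorphic to the prime spectrum, with the Zariski
topology, of some commutative ring with identity. -/
def IsSpectralSpace (X : Type u) [TopologicalSpace X] : Prop :=
  ∃ (A : Type u) (_ : CommRing A), Nonempty (X ≃ₜ PrimeSpectrum A)

/-!
The members of a basis `B` are clopen for the `B`-ultrafilter topology, essentially by definition.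
This makes that topology finer than the given one, and totally separated as soon as `B` separates
points. If it is moreover compact, then it coincides with the coarsest topology making the members
of `B` clopen, since that one is Hausdorff; and the members of `B`, hence their finite unions, hence
all compact open sets, are clopen for it, which identifies it with the patch topology.

The substantial assertion is that `X` is then the prime spectrum of a ring (Hochster's theorem). The
ring is written down directly, with no iterated extension. Let `Uᵢ` be the members of the basis, and
`K = ℚ(tᵢ)` the rational functions with one indeterminate for each `i`. For `x : X` let
`scale x : K → K⸨s⸩` fix `tᵢ` if `x ∈ Uᵢ` and multiply it by `s` otherwise. The ring consists of the
maps `f : X → K` that are locally constant for the compact topology (the *patch* topology) and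
satisfy `scale x (f x) = f x` and `ord (scale x (f y) - scale x (f x)) > 0` whenever `y` is a
generization of `x`, that is, belongs to every `Uᵢ` containing `x`. The nonvanishing locus of such
an `f` is patch-clopen and stable under generization, so by compactness it is open in `X`; that
of the function `tᵢ · 1_{Uᵢ}` is `Uᵢ`. Thus `x ↦ {f | f x = 0}` is an embedding of `X` into the
spectrum. Two facts give surjectivity, through the compactness of the patch topology:

* if `g` vanishes only where `f` does, then some power `f ^ n` is a multiple of `g`
  (`exists_pow_eq_mul`): the pointwise quotient `f ^ n / g` lies in the ring once `n` exceeds the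
  orders of the elements `scale x (g y) ≠ 0`, which are bounded by compactness;
* a finite union of nonvanishing loci of elements of an ideal is contained in the nonvanishing locus
  of one element of the ideal (`exists_mem_forall_ne_zero`), namely of a generic rational combination.
-/

open Topology

/-! ### The scaling homomorphisms -/

namespace Hochster

variable {X ι : Type u} (U : ι → Set X)

/-- The field of rational functions over `ℚ` in indeterminates `tᵢ`, one for each index `i`. -/
abbrev RatFunField (ι : Type u) : Type u := FractionRing (MvPolynomial ι ℚ)

/-- The indeterminate `tᵢ` as a rational function. -/
noncomputable def indet (i : ι) : RatFunField ι :=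
  algebraMap (MvPolynomial ι ℚ) (RatFunField ι) (MvPolynomial.X i)

open Classical in
/-- The homomorphism from polynomials over `ℚ` to `K[s]` that fixes `tᵢ` if `x ∈ Uᵢ` and sends `tᵢ`
to `tᵢ s` otherwise. -/
noncomputable def scalePoly (x : X) : MvPolynomial ι ℚ →+* Polynomial (RatFunField ι) :=
  (MvPolynomial.aeval fun i => if x ∈ U i then Polynomial.C (indet i)
    else Polynomial.C (indet i) * Polynomial.X).toRingHom

/-- Setting `s = 1` recovers the polynomial. -/
theorem scalePoly_injective (x : X) : Function.Injective (scalePoly U x) := by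
  have h : (Polynomial.evalRingHom 1).comp (scalePoly U x) =
      algebraMap (MvPolynomial ι ℚ) (RatFunField ι) := by
    ext i
    · simp
    · by_cases hi : x ∈ U i <;> simp [scalePoly, hi, indet]
  refine Function.Injective.of_comp (f := Polynomial.evalRingHom 1) ?_
  rw [← RingHom.coe_comp, h]
  exact IsFractionRing.injective _ _

/-- `scalePoly`, with values in the field of Laurent series in `s`. -/
noncomputable def scaleLaurent (x : X) : MvPolynomial ι ℚ →+* LaurentSeries (RatFunField ι) :=
  ((HahnSeries.ofPowerSeries ℤ (RatFunField ι)).comp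
    Polynomial.coeToPowerSeries.ringHom).comp (scalePoly U x)

theorem scaleLaurent_injective (x : X) : Function.Injective (scaleLaurent U x) :=
  (HahnSeries.ofPowerSeries_injective.comp (Polynomial.coe_injective _)).comp
    (scalePoly_injective U x)

/-- The field homomorphism `K → K⸨s⸩` that fixes `tᵢ` if `x ∈ Uᵢ` and sends `tᵢ` to `tᵢ s`
otherwise. -/
noncomputable def scale (x : X) : RatFunField ι →+* LaurentSeries (RatFunField ι) :=
  IsFractionRing.lift (scaleLaurent_injective U x)

theorem scale_algebraMap (x : X) (p : MvPolynomial ι ℚ) :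
    scale U x (algebraMap _ _ p) = scaleLaurent U x p :=
  IsFractionRing.lift_algebraMap _ _

theorem indet_ne_zero (i : ι) : indet i ≠ 0 :=
  (map_ne_zero_iff _ (IsFractionRing.injective _ _)).2 (MvPolynomial.X_ne_zero i)

theorem scale_indet_of_mem {x : X} {i : ι} (h : x ∈ U i) :
    scale U x (indet i) = HahnSeries.C (indet i) := by
  rw [indet, scale_algebraMap]
  simp [scaleLaurent, scalePoly, h, indet]

theorem scale_indet_of_notMem {x : X} {i : ι} (h : x ∉ U i) :
    scale U x (indet i) = HahnSeries.C (indet i) * HahnSeries.single 1 1 := by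
  rw [indet, scale_algebraMap]
  simp [scaleLaurent, scalePoly, h, indet]

theorem isLocallyConstant_scale [TopologicalSpace X] (hU : ∀ i, IsClopen (U i))
    (d : RatFunField ι) : IsLocallyConstant fun x => scale U x d := by
  have hp (p : MvPolynomial ι ℚ) :
      IsLocallyConstant fun x => scale U x (algebraMap _ _ p) := by
    induction p using MvPolynomial.induction_on with
    | C a =>
      refine IsLocallyConstant.of_constant _ fun x y => ?_
      simp only [scale_algebraMap, scaleLaurent, scalePoly]
      simp
    | add p q hp hq => simpa using hp.comp₂ hq (· + ·)
    | mul_X p i hp =>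
      simp only [map_mul]
      refine hp.comp₂ ?_ (· * ·)
      refine (IsLocallyConstant.iff_eventually_eq _).2 fun x => ?_
      by_cases hx : x ∈ U i
      · filter_upwards [(hU i).isOpen.mem_nhds hx] with y hy
        exact (scale_indet_of_mem U hy).trans (scale_indet_of_mem U hx).symm
      · filter_upwards [(hU i).compl.isOpen.mem_nhds hx] with y hy
        exact (scale_indet_of_notMem U hy).trans (scale_indet_of_notMem U hx).symm
  obtain ⟨p, q, -, rfl⟩ := IsFractionRing.div_surjective (A := MvPolynomial ι ℚ) d
  simpa only [map_div₀] using (hp p).comp₂ (hp q) (· / ·)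

/-- The order in `s` of a Laurent series over `K`, with value `⊤` at `0`. -/
noncomputable abbrev laurentOrd (ι : Type u) :
    AddValuation (LaurentSeries (RatFunField ι)) (WithTop ℤ) :=
  HahnSeries.addVal ℤ (RatFunField ι)

theorem laurentOrd_C {c : RatFunField ι} (hc : c ≠ 0) : laurentOrd ι (HahnSeries.C c) = 0 := by
  rw [HahnSeries.addVal_apply_of_ne (by simpa using hc), HahnSeries.order_C, WithTop.coe_zero]

theorem one_le_of_pos {a : WithTop ℤ} (h : 0 < a) : 1 ≤ a := by
  induction a using WithTop.recTopCoe with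
  | top => exact le_top
  | coe a => exact WithTop.coe_le_coe.2 (WithTop.coe_pos.1 h)

theorem laurentOrd_C_nonneg (c : RatFunField ι) : 0 ≤ laurentOrd ι (HahnSeries.C c) := by
  by_cases hc : c = 0
  · simp [hc]
  · exact (laurentOrd_C hc).ge

/-- As `scale U x d` is locally constant in `x`, it takes only finitely many values. -/
theorem exists_forall_laurentOrd_scale_le [TopologicalSpace X] [CompactSpace X]
    (hU : ∀ i, IsClopen (U i)) {S : Set (RatFunField ι)} (hS : S.Finite) :
    ∃ n : ℕ, ∀ d ∈ S, d ≠ 0 → ∀ x, laurentOrd ι (scale U x d) ≤ (n : ℤ) := by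
  have hfin : (⋃ d ∈ S, range fun x => (scale U x d).order.toNat).Finite :=
    hS.biUnion fun d _ => ((isLocallyConstant_scale U hU d).comp fun z => z.order.toNat).range_finite
  obtain ⟨n, hn⟩ := hfin.bddAbove
  refine ⟨n, fun d hd hd0 x => ?_⟩
  rw [HahnSeries.addVal_apply_of_ne ((map_ne_zero _).2 hd0), WithTop.coe_le_coe]
  have hle := hn (mem_biUnion hd ⟨x, rfl⟩)
  simp only at hle
  lia

/-! ### The ring of functions -/

/-- The ring whose spectrum is `X`, for the topology generated by the sets `Uᵢ`. The topology on `X`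
that is an instance argument is the patch topology, for which the `Uᵢ` are clopen. The condition
`∀ i, x ∈ U i → y ∈ U i` says that `y` is a generization of `x`. -/
noncomputable def hochsterRing [TopologicalSpace X] : Subring (X → RatFunField ι) where
  carrier := {f | IsLocallyConstant f ∧ (∀ x, scale U x (f x) = HahnSeries.C (f x)) ∧
    ∀ x y, (∀ i, x ∈ U i → y ∈ U i) → 0 < laurentOrd ι (scale U x (f y) - scale U x (f x))}
  zero_mem' := ⟨.const _, by simp, by simp⟩
  one_mem' := ⟨.const _, by simp, by simp⟩
  add_mem' := by
    rintro f g ⟨hf₁, hf₂, hf₃⟩ ⟨hg₁, hg₂, hg₃⟩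
    refine ⟨hf₁.add hg₁, fun x => by simp [hf₂, hg₂], fun x y h => ?_⟩
    have e : scale U x ((f + g) y) - scale U x ((f + g) x) =
        (scale U x (f y) - scale U x (f x)) + (scale U x (g y) - scale U x (g x)) := by
      simp only [Pi.add_apply, map_add]; ring
    rw [e]
    exact (laurentOrd ι).map_lt_add (hf₃ x y h) (hg₃ x y h)
  neg_mem' := by
    rintro f ⟨hf₁, hf₂, hf₃⟩
    refine ⟨hf₁.neg, fun x => by simp [hf₂], fun x y h => ?_⟩
    have e : scale U x ((-f) y) - scale U x ((-f) x) =
        -(scale U x (f y) - scale U x (f x)) := by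
      simp only [Pi.neg_apply, map_neg]; ring
    rw [e, (laurentOrd ι).map_neg]
    exact hf₃ x y h
  mul_mem' := by
    rintro f g ⟨hf₁, hf₂, hf₃⟩ ⟨hg₁, hg₂, hg₃⟩
    refine ⟨hf₁.mul hg₁, fun x => by simp [hf₂, hg₂], fun x y h => ?_⟩
    have e : scale U x ((f * g) y) - scale U x ((f * g) x) =
        (scale U x (f y) - scale U x (f x)) * (scale U x (g y) - scale U x (g x)) +
        ((scale U x (f y) - scale U x (f x)) * scale U x (g x) +
          scale U x (f x) * (scale U x (g y) - scale U x (g x))) := by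
      simp only [Pi.mul_apply, map_mul]; ring
    rw [e]
    refine (laurentOrd ι).map_lt_add ?_ ((laurentOrd ι).map_lt_add ?_ ?_) <;>
      rw [(laurentOrd ι).map_mul]
    · exact (hf₃ x y h).trans_le (le_add_of_nonneg_right (hg₃ x y h).le)
    · rw [hg₂]; exact (hf₃ x y h).trans_le (le_add_of_nonneg_right (laurentOrd_C_nonneg _))
    · rw [hf₂]; exact (hg₃ x y h).trans_le (le_add_of_nonneg_left (laurentOrd_C_nonneg _))

variable [TopologicalSpace X]

variable {U}

theorem laurentOrd_scale_self {f : X → RatFunField ι} (hf : f ∈ hochsterRing U) {x : X}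
    (hx : f x ≠ 0) : laurentOrd ι (scale U x (f x)) = 0 := by
  rw [hf.2.1, laurentOrd_C hx]

theorem laurentOrd_scale_pos {f : X → RatFunField ι} (hf : f ∈ hochsterRing U) {x y : X}
    (h : ∀ i, x ∈ U i → y ∈ U i) (hx : f x = 0) : 0 < laurentOrd ι (scale U x (f y)) := by
  simpa [hx] using hf.2.2 x y h

theorem laurentOrd_scale_eq_zero {f : X → RatFunField ι} (hf : f ∈ hochsterRing U) {x y : X}
    (h : ∀ i, x ∈ U i → y ∈ U i) (hx : f x ≠ 0) : laurentOrd ι (scale U x (f y)) = 0 := by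
  rw [← laurentOrd_scale_self hf hx]
  refine (laurentOrd ι).map_eq_of_lt_sub ?_
  rw [laurentOrd_scale_self hf hx]
  exact hf.2.2 x y h

/-- The nonvanishing locus of an element of `hochsterRing U` is stable under generization. -/
theorem ne_zero_of_generization {f : X → RatFunField ι} (hf : f ∈ hochsterRing U) {x y : X}
    (h : ∀ i, x ∈ U i → y ∈ U i) (hx : f x ≠ 0) : f y ≠ 0 := by
  intro hy
  have := laurentOrd_scale_eq_zero hf h hx
  simp [hy] at this

theorem const_mem_hochsterRing (c : ℚ) :
    (fun _ : X => algebraMap ℚ (RatFunField ι) c) ∈ hochsterRing U :=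
  ⟨.const _, fun x => by simp, fun x y _ => by simp⟩

open Classical in
/-- The function `tᵢ · 1_{Uᵢ}`, whose nonvanishing locus is `Uᵢ`, lies in the ring. -/
theorem indicator_indet_mem_hochsterRing (hU : ∀ i, IsClopen (U i)) (i : ι) :
    (fun x => if x ∈ U i then indet i else 0) ∈ hochsterRing U := by
  refine ⟨?_, fun x => ?_, fun x y h => ?_⟩
  · refine (IsLocallyConstant.iff_eventually_eq _).2 fun x => ?_
    by_cases hx : x ∈ U i
    · filter_upwards [(hU i).isOpen.mem_nhds hx] with y hy
      rw [if_pos hx, if_pos hy]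
    · filter_upwards [(hU i).compl.isOpen.mem_nhds hx] with y hy
      rw [if_neg hx, if_neg hy]
  · by_cases hx : x ∈ U i
    · simp [hx, scale_indet_of_mem U hx]
    · simp [hx]
  · by_cases hx : x ∈ U i
    · simp [hx, h i hx]
    · by_cases hy : y ∈ U i
      · simp only [hx, hy, if_true, if_false, map_zero, sub_zero, scale_indet_of_notMem U hx,
          (laurentOrd ι).map_mul]
        refine lt_of_lt_of_le ?_ (le_add_of_nonneg_left (laurentOrd_C_nonneg _))
        rw [HahnSeries.addVal_apply_of_ne (by simp), HahnSeries.order_single one_ne_zero]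
        exact WithTop.coe_pos.2 one_pos
      · simp [hx, hy]

/-- If the nonvanishing locus of `f` is contained in that of `g`, then `f` is in the radical of the
ideal generated by `g`. -/
theorem exists_pow_eq_mul [CompactSpace X] (hU : ∀ i, IsClopen (U i)) (f g : hochsterRing U)
    (hfg : ∀ x, f.1 x ≠ 0 → g.1 x ≠ 0) : ∃ (n : ℕ) (h : hochsterRing U), f ^ n = h * g := by
  obtain ⟨n, hn⟩ := exists_forall_laurentOrd_scale_le U hU g.2.1.range_finite
  have hF := (f ^ (n + 1)).2
  have hFx (x : X) : (f ^ (n + 1)).1 x = f.1 x ^ (n + 1) := rfl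
  set F := (f ^ (n + 1)).1
  -- The quotient is `0` where `g` vanishes, by the convention `a / 0 = 0`.
  refine ⟨n + 1, ⟨fun x => F x / g.1 x, hF.1.comp₂ g.2.1 (· / ·), fun x => ?_, fun x y h => ?_⟩, ?_⟩
  · rw [map_div₀, map_div₀, hF.2.1, g.2.2.1]
  · by_cases hx : g.1 x = 0
    · have hfx : f.1 x = 0 := by_contra fun h' => hfg x h' hx
      by_cases hy : g.1 y = 0
      · simp [hx, hy]
      have e : laurentOrd ι (scale U x (F y / g.1 y)) + laurentOrd ι (scale U x (g.1 y)) =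
          (n + 1) • laurentOrd ι (scale U x (f.1 y)) := by
        rw [← (laurentOrd ι).map_mul, ← map_mul, div_mul_cancel₀ _ hy, hFx, map_pow,
          (laurentOrd ι).map_pow]
      simp only [hx, div_zero, map_zero, sub_zero]
      -- The numerator has order at least `n + 1`, the denominator at most `n`.
      by_contra! hle
      have h1 : (1 : WithTop ℤ) ≤ laurentOrd ι (scale U x (f.1 y)) :=
        one_le_of_pos (laurentOrd_scale_pos f.2 h hfx)
      have h2 : (n + 1) • (1 : WithTop ℤ) ≤ 0 + ((n : ℤ) : WithTop ℤ) :=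
        (nsmul_le_nsmul_right h1 _).trans
          (e.symm.le.trans (add_le_add hle (hn _ ⟨y, rfl⟩ hy x)))
      rw [zero_add, nsmul_one] at h2
      have h3 : ((n + 1 : ℤ) : WithTop ℤ) ≤ ((n : ℤ) : WithTop ℤ) := by exact_mod_cast h2
      rw [WithTop.coe_le_coe] at h3
      lia
    · have hy := ne_zero_of_generization g.2 h hx
      have hgx : scale U x (g.1 x) ≠ 0 := (map_ne_zero _).2 hx
      have hgy : scale U x (g.1 y) ≠ 0 := (map_ne_zero _).2 hy
      have e : scale U x (F y / g.1 y) - scale U x (F x / g.1 x) =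
          ((scale U x (F y) - scale U x (F x)) * scale U x (g.1 x) -
            scale U x (F x) * (scale U x (g.1 y) - scale U x (g.1 x))) /
            (scale U x (g.1 y) * scale U x (g.1 x)) := by
        rw [map_div₀, map_div₀]
        field_simp
        ring
      rw [e, (laurentOrd ι).map_div, (laurentOrd ι).map_mul, laurentOrd_scale_self g.2 hx,
        laurentOrd_scale_eq_zero g.2 h hx, add_zero, sub_zero]
      refine lt_of_lt_of_le (lt_min ?_ ?_) ((laurentOrd ι).map_sub _ _) <;>
        rw [(laurentOrd ι).map_mul]
      · rw [laurentOrd_scale_self g.2 hx, add_zero]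
        exact hF.2.2 x y h
      · rw [hF.2.1]
        exact (g.2.2.2 x y h).trans_le (le_add_of_nonneg_left (laurentOrd_C_nonneg _))
  · ext x
    by_cases hx : g.1 x = 0
    · have hfx : f.1 x = 0 := by_contra fun h' => hfg x h' hx
      simp [hx, hfx]
    · simp [F, hx]

/-- The union of the nonvanishing loci of `f` and `g` is contained in that of `f + c g`, for every
`c : ℚ` outside the finite set of values of `-f / g`. -/
theorem exists_mem_ne_zero_of_or [CompactSpace X] (I : Ideal (hochsterRing U))
    {f g : hochsterRing U} (hf : f ∈ I) (hg : g ∈ I) :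
    ∃ h ∈ I, ∀ x, f.1 x ≠ 0 ∨ g.1 x ≠ 0 → h.1 x ≠ 0 := by
  have hfin : (range fun x => -f.1 x / g.1 x).Finite :=
    (f.2.1.comp₂ g.2.1 (fun a b => -a / b)).range_finite
  obtain ⟨c, hc⟩ := (hfin.preimage (algebraMap ℚ (RatFunField ι)).injective.injOn).exists_notMem
  refine ⟨f + ⟨_, const_mem_hochsterRing c⟩ * g, I.add_mem hf (I.mul_mem_left _ hg),
    fun x hx h => ?_⟩
  change f.1 x + algebraMap ℚ (RatFunField ι) c * g.1 x = 0 at h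
  by_cases hgx : g.1 x = 0
  · simp [hgx] at h hx
    exact hx h
  · exact hc ⟨x, by rw [div_eq_iff hgx]; linear_combination -h⟩

theorem exists_mem_forall_ne_zero [CompactSpace X] (I : Ideal (hochsterRing U))
    (s : Finset (hochsterRing U)) (hs : ∀ f ∈ s, f ∈ I) :
    ∃ g ∈ I, ∀ f ∈ s, ∀ x, f.1 x ≠ 0 → g.1 x ≠ 0 := by
  classical
  induction s using Finset.induction_on with
  | empty => exact ⟨0, I.zero_mem, by simp⟩
  | insert f s _ ih =>
    obtain ⟨g, hg, hgs⟩ := ih fun a ha => hs a (Finset.mem_insert_of_mem ha)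
    obtain ⟨h, hh, hfg⟩ := exists_mem_ne_zero_of_or I (hs f (Finset.mem_insert_self _ _)) hg
    refine ⟨h, hh, fun a ha x hx => hfg x ?_⟩
    rcases Finset.mem_insert.1 ha with rfl | ha
    · exact Or.inl hx
    · exact Or.inr (hgs a ha x hx)

/-! ### The points of the spectrum -/

variable (U) in
/-- The prime ideal of the functions that vanish at `x`. -/
noncomputable def vanishingPrime (x : X) : PrimeSpectrum (hochsterRing U) :=
  ⟨RingHom.ker ((Pi.evalRingHom _ x).comp (hochsterRing U).subtype), RingHom.ker_isPrime _⟩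

theorem mem_vanishingPrime {x : X} {f : hochsterRing U} :
    f ∈ (vanishingPrime U x).asIdeal ↔ f.1 x = 0 :=
  Iff.rfl

theorem vanishingPrime_surjective [CompactSpace X] (hU : ∀ i, IsClopen (U i)) :
    Function.Surjective (vanishingPrime U) := by
  classical
  intro p
  by_contra! hp
  -- `V f` is the patch-open set of the points `x` at which membership of `f` shows that `p` is not
  -- the ideal of functions vanishing at `x`.
  let V (f : hochsterRing U) : Set X := f.1 ⁻¹' {a | ¬ (f ∈ p.asIdeal ↔ a = 0)}
  have hcov : univ ⊆ ⋃ f, V f := fun x _ => by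
    by_contra hx
    refine hp x (PrimeSpectrum.ext (Ideal.ext fun f => ?_))
    rw [mem_vanishingPrime]
    by_contra hf
    exact hx (mem_iUnion.2 ⟨f, fun h => hf h.symm⟩)
  obtain ⟨s, hs⟩ := isCompact_univ.elim_finite_subcover V (fun f => f.2.1 _) hcov
  obtain ⟨g, hg, hgs⟩ := exists_mem_forall_ne_zero p.asIdeal (s.filter (· ∈ p.asIdeal))
    fun f hf => (Finset.mem_filter.1 hf).2
  obtain ⟨n, h, e⟩ := exists_pow_eq_mul hU (∏ f ∈ s.filter (· ∉ p.asIdeal), f) g fun x hx => by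
    obtain ⟨f, hf, hfx⟩ := mem_iUnion₂.1 (hs (mem_univ x))
    by_cases hfp : f ∈ p.asIdeal
    · exact hgs f (Finset.mem_filter.2 ⟨hf, hfp⟩) x fun h0 => hfx ⟨fun _ => h0, fun _ => hfp⟩
    · have hfx0 : f.1 x = 0 := by
        by_contra h0
        exact hfx ⟨fun h' => absurd h' hfp, fun h' => absurd h' h0⟩
      refine absurd ?_ hx
      rw [← mem_vanishingPrime]
      exact Ideal.mem_of_dvd _ (Finset.dvd_prod_of_mem _ (Finset.mem_filter.2 ⟨hf, hfp⟩))
        (mem_vanishingPrime.2 hfx0)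
  have hmem := p.isPrime.mem_of_pow_mem n (e ▸ p.asIdeal.mul_mem_left h hg)
  obtain ⟨f, hf, hfp⟩ := (p.isPrime.prod_mem_iff).1 hmem
  exact (Finset.mem_filter.1 hf).2 hfp

/-- The nonvanishing locus of an element of `hochsterRing U` is open for the topology generated by
the sets `Uᵢ`: its complement is compact for the patch topology, and is covered by the complements
of the `Uᵢ` that contain `x`. -/
theorem exists_finset_subset_support [CompactSpace X] (hU : ∀ i, IsClopen (U i))
    (f : hochsterRing U) {x : X} (hx : f.1 x ≠ 0) :
    ∃ s : Finset ι, (∀ i ∈ s, x ∈ U i) ∧ ∀ y, (∀ i ∈ s, y ∈ U i) → f.1 y ≠ 0 := by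
  have hK : IsCompact {y | f.1 y = 0} := (f.2.1.isClosed_fiber 0).isCompact
  obtain ⟨s, hs⟩ := hK.elim_finite_subcover (fun i : {i // x ∈ U i} => (U i)ᶜ)
    (fun i => (hU i).compl.isOpen) fun y hy => by
      by_contra h
      simp only [mem_iUnion, not_exists, mem_compl_iff, not_not, Subtype.forall] at h
      exact ne_zero_of_generization f.2 h hx hy
  classical
  refine ⟨s.image Subtype.val, by simp +contextual, fun y hy h0 => ?_⟩
  obtain ⟨i, hi, hyi⟩ := mem_iUnion₂.1 (hs h0)
  exact hyi (hy i (Finset.mem_image_of_mem _ hi))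

end Hochster

/-- A form of Hochster's theorem: a `T₀` space is spectral if some compact topology `t` makes every
member of a basis clopen. -/
theorem isSpectralSpace_of_isTopologicalBasis {X : Type u} (t : TopologicalSpace X)
    (ht : CompactSpace X) [TopologicalSpace X] [T0Space X] {B : Set (Set X)}
    (hB : TopologicalSpace.IsTopologicalBasis B) (hBt : ∀ U ∈ B, @IsClopen X t U) :
    IsSpectralSpace X := by
  classical
  let U : B → Set X := Subtype.val
  have hU : ∀ i, @IsClopen X t (U i) := fun i => hBt i i.2
  let A := @Hochster.hochsterRing X B U t
  let e : X → PrimeSpectrum A := @Hochster.vanishingPrime X B U t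
  have hind (i : B) : ∃ f : A, ∀ x, f.1 x ≠ 0 ↔ x ∈ U i := by
    refine ⟨⟨_, @Hochster.indicator_indet_mem_hochsterRing X B U t hU i⟩, fun x => ?_⟩
    by_cases hx : x ∈ U i <;> simp [hx, Hochster.indet_ne_zero]
  have hbasic (f : A) :
      e ⁻¹' (PrimeSpectrum.basicOpen f : Set (PrimeSpectrum A)) = {x | f.1 x ≠ 0} := rfl
  have hopen (f : A) : IsOpen {x | f.1 x ≠ 0} := by
    refine isOpen_iff_mem_nhds.2 fun x hx => ?_
    obtain ⟨s, hxs, hs⟩ := @Hochster.exists_finset_subset_support X B U t ht hU f x hx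
    filter_upwards [(Filter.biInter_finset_mem s).2 fun i hi =>
      (hB.isOpen i.2).mem_nhds (hxs i hi)] with y hy
    exact hs y fun i hi => mem_iInter₂.1 hy i hi
  have hinducing : IsInducing e := by
    refine ⟨le_antisymm ?_ ?_⟩
    · refine continuous_iff_le_induced.1
        (PrimeSpectrum.isTopologicalBasis_basic_opens.continuous_iff.2 ?_)
      rintro _ ⟨f, rfl⟩
      rw [hbasic]
      exact hopen f
    · rw [hB.eq_generateFrom]
      refine le_generateFrom fun V hV => ?_
      obtain ⟨f, hf⟩ := hind ⟨V, hV⟩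
      refine ⟨_, (PrimeSpectrum.basicOpen f).isOpen, ?_⟩
      rw [hbasic]
      exact ext hf
  exact ⟨A, inferInstance, ⟨(Equiv.ofBijective e ⟨hinducing.injective,
    @Hochster.vanishingPrime_surjective X B U t ht hU⟩).toHomeomorphOfIsInducing hinducing⟩⟩

/-! ### Topologies in which the members of a basis are clopen -/

section UltrafilterTopology

variable {X : Type u}

theorem isClosed_ultrafilterTopology_iff {𝓕 : Set (Set X)} {C : Set X} :
    IsClosed[ultrafilterTopology 𝓕] C ↔
      ∀ 𝒱 : Ultrafilter X, C ∈ 𝒱 → ∀ x, (∀ F ∈ 𝓕, x ∈ F ↔ F ∈ 𝒱) → x ∈ C := by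
  rw [← stableUnderUltrafilters_iff]
  rw [← @isOpen_compl_iff X C (ultrafilterTopology 𝓕)]
  change StableUnderUltrafilters 𝓕 Cᶜᶜ ↔ _
  rw [compl_compl]

theorem isClopen_ultrafilterTopology {𝓕 : Set (Set X)} {F : Set X} (hF : F ∈ 𝓕) :
    @IsClopen X (ultrafilterTopology 𝓕) F := by
  refine ⟨isClosed_ultrafilterTopology_iff.2 fun 𝒱 h𝒱 x hx => (hx F hF).2 h𝒱,
    (@isClosed_compl_iff X (ultrafilterTopology 𝓕) F).1
      (isClosed_ultrafilterTopology_iff.2 fun 𝒱 h𝒱 x hx hxF => ?_)⟩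
  exact Ultrafilter.compl_mem_iff_notMem.1 h𝒱 ((hx F hF).1 hxF)

theorem ultrafilterTopology_le [T : TopologicalSpace X] {B : Set (Set X)}
    (hB : TopologicalSpace.IsTopologicalBasis B) : ultrafilterTopology B ≤ T := by
  rw [hB.eq_generateFrom]
  exact le_generateFrom fun U hU => (isClopen_ultrafilterTopology hU).2

theorem totallySeparatedSpace_of_isClopen [TopologicalSpace X] {B : Set (Set X)}
    (hsep : ∀ x y, (∀ U ∈ B, x ∈ U ↔ y ∈ U) → x = y) (h : ∀ U ∈ B, IsClopen U) :
    TotallySeparatedSpace X := by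
  refine ⟨fun x _ y _ hxy => ?_⟩
  obtain ⟨U, hU, hxyU⟩ : ∃ U ∈ B, ¬ (x ∈ U ↔ y ∈ U) := by
    by_contra! hcon
    exact hxy (hsep x y hcon)
  have hcl := h U hU
  by_cases hx : x ∈ U
  · exact ⟨U, Uᶜ, hcl.isOpen, hcl.compl.isOpen, hx, fun hy => hxyU (iff_of_true hx hy),
      (union_compl_self U).ge, disjoint_compl_right⟩
  · refine ⟨Uᶜ, U, hcl.compl.isOpen, hcl.isOpen, hx, ?_, (compl_union_self U).ge,
      disjoint_compl_left⟩
    by_contra hy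
    exact hxyU (iff_of_false hx hy)

/-- A compact topology in which the members of a point-separating family are clopen is the coarsest
such topology, because the topology generated by the members and their complements is Hausdorff. -/
theorem isGreatest_of_isClopen (t : TopologicalSpace X) [hc : CompactSpace X] {B : Set (Set X)}
    (hsep : ∀ x y, (∀ U ∈ B, x ∈ U ↔ y ∈ U) → x = y) (h : ∀ U ∈ B, IsClopen U) :
    IsGreatest {s : TopologicalSpace X | ∀ U ∈ B, @IsClopen X s U} t := by
  refine ⟨h, fun s hs => ?_⟩
  let r : TopologicalSpace X := .generateFrom {V | V ∈ B ∨ Vᶜ ∈ B}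
  have hr : ∀ U ∈ B, @IsClopen X r U := fun U hU =>
    ⟨(@isOpen_compl_iff X U r).1 (.basic _ (Or.inr (by rwa [compl_compl]))), .basic _ (Or.inl hU)⟩
  have hle (q : TopologicalSpace X) (hq : ∀ U ∈ B, @IsClopen X q U) : q ≤ r := by
    refine le_generateFrom ?_
    rintro V (hV | hV)
    · exact (hq V hV).2
    · exact (@isClosed_compl_iff X q V).1 (hq _ hV).1
  have hT2 : @T2Space X r :=
    @TotallySeparatedSpace.t2Space X r (@totallySeparatedSpace_of_isClopen X r B hsep hr)
  have hclosed := @Continuous.isClosedMap X X t r hc hT2 id (continuous_id_iff_le.2 (hle t h))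
  have hrt : r ≤ t := by
    refine TopologicalSpace.le_def.2 fun V hV => ?_
    have := hclosed Vᶜ ((@isClosed_compl_iff X t V).2 hV)
    rw [image_id] at this
    exact (@isClosed_compl_iff X r V).1 this
  exact (hle s hs).trans hrt

/-- In a compact topology `t` in which the members of `B` are clopen, so are the compact open sets
of `X`, being finite unions of members of `B`; conversely the members of `B` are compact. -/
theorem constructibleTopology_eq_of_isClopen {B : Set (Set X)} (t : TopologicalSpace X)
    (hc : CompactSpace X) [T : TopologicalSpace X] [T0Space X]
    (hB : TopologicalSpace.IsTopologicalBasis B) (h : ∀ U ∈ B, @IsClopen X t U) :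
    constructibleTopology X = t := by
  have hle : t ≤ T := by
    rw [hB.eq_generateFrom]
    exact le_generateFrom fun U hU => (h U hU).2
  have hsep (x y : X) (hxy : ∀ U ∈ B, x ∈ U ↔ y ∈ U) : x = y := (hB.inseparable_iff.2 hxy).eq
  refine le_antisymm ((isGreatest_of_isClopen t hsep h).2 fun U hU => ?_) (le_generateFrom ?_)
  · have hK : IsCompact U := by
      simpa using @IsCompact.image X X t T U id (@IsClosed.isCompact X t U hc (h U hU).1)
        (continuous_id_iff_le.2 hle)
    refine ⟨(@isOpen_compl_iff X U (constructibleTopology X)).1 ?_,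
      hK.isOpen_constructibleTopology_of_isOpen (hB.isOpen hU)⟩
    exact IsCompact.isOpen_constructibleTopology_of_isClosed (by rwa [compl_compl])
      (hB.isOpen hU).isClosed_compl
  · have hKO {V : Set X} (hV : IsCompact V) (hVo : IsOpen V) : @IsClopen X t V := by
      obtain ⟨s, hs, rfl⟩ := eq_finite_iUnion_of_isTopologicalBasis_of_isCompact_open
        (Subtype.val : B → Set X) (by simpa using hB) V hV hVo
      exact @Set.Finite.isClopen_biUnion X t _ s _ hs fun i _ => h i i.2
    rintro V (⟨hVo, hV⟩ | ⟨hVc, hV⟩)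
    · exact (hKO hV hVo).2
    · exact (@isClosed_compl_iff X t V).1 (hKO hV hVc.isOpen_compl).1

end UltrafilterTopology

/-- In Mathlib's order on `TopologicalSpace X`, `s ≤ t` means that `s` is finer than or equal to
`t`, so the greatest element of a set of topologies is its coarsest one. `constructibleTopology X`
is the patch topology: a subbasis is formed by the compact open sets and their complements. -/
theorem proposition3p1 {X : Type u} [T : TopologicalSpace X] (B : Set (Set X))
    (hB : TopologicalSpace.IsTopologicalBasis B) :
    ultrafilterTopology B ≤ T ∧
    (T0Space X →
      @T2Space X (ultrafilterTopology B) ∧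
      @TotallyDisconnectedSpace X (ultrafilterTopology B) ∧
      (¬ T2Space X → ultrafilterTopology B < T)) ∧
    (T0Space X → @CompactSpace X (ultrafilterTopology B) →
      IsGreatest {t : TopologicalSpace X | ∀ U ∈ B, @IsClopen X t U} (ultrafilterTopology B) ∧
      constructibleTopology X = ultrafilterTopology B ∧
      IsSpectralSpace X) := by
  have hclopen : ∀ U ∈ B, @IsClopen X (ultrafilterTopology B) U :=
    fun U hU => isClopen_ultrafilterTopology hU
  have hle : ultrafilterTopology B ≤ T := ultrafilterTopology_le hB
  have hsep (_ : T0Space X) (x y : X) (hxy : ∀ U ∈ B, x ∈ U ↔ y ∈ U) : x = y :=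
    (hB.inseparable_iff.2 hxy).eq
  refine ⟨hle, fun h0 => ?_, fun h0 hc => ⟨@isGreatest_of_isClopen X _ hc B (hsep h0) hclopen,
    constructibleTopology_eq_of_isClopen _ hc hB hclopen,
    isSpectralSpace_of_isTopologicalBasis _ hc hB hclopen⟩⟩
  have hts := @totallySeparatedSpace_of_isClopen X (ultrafilterTopology B) B (hsep h0) hclopen
  have hT2 := @TotallySeparatedSpace.t2Space X (ultrafilterTopology B) hts
  exact ⟨hT2, @TotallySeparatedSpace.totallyDisconnectedSpace X (ultrafilterTopology B) hts,
    fun hT => lt_of_le_of_ne hle fun h => hT (h ▸ hT2)⟩
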